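/- **Conventions.** $L$ is a first-order language with equality whose symbols are numbered in a recursive way (it is decidable whether a given number is the number of a function symbol, or of a relation symbol, of a given arity); $\ulcorner\phi\urcorner$ is the Gödel number of a formula $\phi$ of $L$. An RE theory $T$ in $L$ is a set of sentences (axioms) of $L$ whose Gödel numbers form a recursively enumerable set; $T\vdash\phi$ means that $\phi$ is derivable from $T$ in classical first-order logic with equality, and $T$ is consistent if $T\nvdash\bot$. $\mathsf{Num}$ is the theory in the language $\{\mathbf 0,\mathbf S\}$ with the axioms $\overline m\neq\overline n$ for all natural numbers $m\ne n$, where $\overline 0=\mathbf 0$ and $\overline{n+1}=\mathbf S\overline n$. An interpretation $I$ of $\mathsf{Num}$ in $T$ is given by $L$-formulas $\delta_I(x)$ (the domain), $x=_I y$, $\mathbf 0_I(y)$ and $\mathbf S_I(x,y)$ such that $T$ proves that $\mathbf 0_I$ and $\mathbf S_I$ are total on $\delta_I$, and proves the $I$-translations of the axioms of equality and of all theorems of $\mathsf{Num}$. If $T$ is a relational extension of $\mathsf{Num}$ (the function symbols of $L$ are exactly $\mathbf 0$ and $\mathbf S$, and $T$ proves the axioms of $\mathsf{Num}$), then $I$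 is required to be the identity interpretation. For a formula $\phi(x_1,\dots,x_n)$ and $\vec a\in\mathbb N^n$, $\phi(\overline{a_1}^I,\dots,\overline{a_n}^I)$ is the sentence saying that there are $x_1,\dots,x_n$ in $\delta_I$ such that $x_k$ equals the numeral of $a_k$ in the sense of $I$ for every $k$, and $\phi(x_1,\dots,x_n)$ holds. For $n\ge 1$ let $R^n_0,R^n_1,\dots$ be an acceptable listing of all $n$-ary RE relations on $\mathbb N$, that is, the relation $\vec a\in R^n_i$ is RE in $(i,\vec a)$, and for every sequence $(S_i)_{i\in\mathbb N}$ of $n$-ary relations such that $\vec a\in S_i$ is RE in $(i,\vec a)$ there is a recursive function $h$ with $R^n_{h(i)}=S_i$ for all $i$. * $T$ is *effectively $n$-Rosser* if there are an interpretation $I$ of $\mathsf{Num}$ in $T$ as above and a recursive function $f(i,j)$ such that for all $i,j$, $f(i,j)$ is the Gödel number of a formula $\phi(x_1,\dots,x_n)$ with exactly the free variables $x_1,\dots,x_n$ such that for all $\vec a\in\mathbb N^n$: if $\vec a\in R^n_i\setminus R^n_j$ then $T\vdash\phi(\overline{a_1}^I,\dots,\overline{a_n}^I)$, and if $\vec a\in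 R^n_j\setminus R^n_i$ then $T\vdash\neg\phi(\overline{a_1}^I,\dots,\overline{a_n}^I)$. * $T$ is *effectively exact $n$-Rosser* if there are an interpretation $I$ of $\mathsf{Num}$ in $T$ as above and a recursive function $f(i,j)$ such that for all $i,j$ with $R^n_i\cap R^n_j=\emptyset$, $f(i,j)$ is the Gödel number of a formula $\phi(x_1,\dots,x_n)$ with exactly the free variables $x_1,\dots,x_n$ such that for all $\vec a\in\mathbb N^n$: $\vec a\in R^n_i\Leftrightarrow T\vdash\phi(\overline{a_1}^I,\dots,\overline{a_n}^I)$, and $\vec a\in R^n_j\Leftrightarrow T\vdash\neg\phi(\overline{a_1}^I,\dots,\overline{a_n}^I)$. **Theorem.** Let $T$ be a consistent RE theory. Then for every $n\ge 1$, $T$ is effectively $n$-Rosser if and only if $T$ is effectively exact $n$-Rosser. -/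

import Mathlib

universe u v u' v'

namespace Rosser

open scoped FirstOrder

/-! ### First-order formulas over a Mathlib language -/

/-- First-order formulas with equality. The terms are Mathlib's terms with variables indexed by `ℕ`;
variables are de Bruijn indices: in `all φ` the quantifier binds variable `0` of `φ`, and variable
`i + 1` of `φ` is variable `i` of `all φ`. -/
inductive Fml (L : FirstOrder.Language.{u, v}) : Type (max u v)
  | falsum : Fml L
  | equal (t s : L.Term ℕ) : Fml L
  | rel {k : ℕ} (R : L.Relations k) (ts : Fin k → L.Term ℕ) : Fml L
  | imp (φ ψ : Fml L) : Fml L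
  | all (φ : Fml L) : Fml L

namespace Fml

variable {L : FirstOrder.Language.{u, v}}

def neg (φ : Fml L) : Fml L := imp φ falsum

def and (φ ψ : Fml L) : Fml L := neg (imp φ (neg ψ))

def ex (φ : Fml L) : Fml L := neg (all (neg φ))

/-- `k` universal quantifiers, binding the variables `0, …, k - 1`. -/
def alls : ℕ → Fml L → Fml L
  | 0, φ => φ
  | k + 1, φ => alls k (all φ)

/-- `k` existential quantifiers, binding the variables `0, …, k - 1`. -/
def exs : ℕ → Fml L → Fml L
  | 0, φ => φ
  | k + 1, φ => exs k (ex φ)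

/-- The conjunction of a list of formulas. -/
def conj : List (Fml L) → Fml L
  | [] => neg falsum
  | φ :: l => and φ (conj l)

/-- The set of free variables of a formula. -/
def freeVars : Fml L → Set ℕ
  | falsum => ∅
  | equal t s => {i | i ∈ t.varFinset ∨ i ∈ s.varFinset}
  | rel _ ts => {i | ∃ j, i ∈ (ts j).varFinset}
  | imp φ ψ => φ.freeVars ∪ ψ.freeVars
  | all φ => {i | i + 1 ∈ φ.freeVars}

/-- A sentence is a formula without free variables. -/
def IsSentence (φ : Fml L) : Prop := φ.freeVars = ∅

/-- The substitution `σ` pushed under a quantifier. -/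
def up (σ : ℕ → L.Term ℕ) : ℕ → L.Term ℕ
  | 0 => FirstOrder.Language.Term.var 0
  | i + 1 => (σ i).relabel Nat.succ

/-- Simultaneous (capture-avoiding) substitution of terms for the free variables. -/
def subst : (ℕ → L.Term ℕ) → Fml L → Fml L
  | _, falsum => falsum
  | σ, equal t s => equal (t.subst σ) (s.subst σ)
  | σ, rel R ts => rel R (fun j => (ts j).subst σ)
  | σ, imp φ ψ => imp (subst σ φ) (subst σ ψ)
  | σ, all φ => all (subst (up σ) φ)

/-- Renaming of the free variables. -/
def rename (ρ : ℕ → ℕ) (φ : Fml L) : Fml L :=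
  subst (fun i => FirstOrder.Language.Term.var (ρ i)) φ

/-- The instance `φ[t]` of `all φ`: variable `0` becomes `t`, variable `i + 1` becomes `i`. -/
def inst (φ : Fml L) (t : L.Term ℕ) : Fml L :=
  subst (fun i => Nat.casesOn i t FirstOrder.Language.Term.var) φ

end Fml

/-! ### Provability -/

/-- Derivability from `T` in a Hilbert calculus for classical first-order logic with equality. -/
inductive Provable {L : FirstOrder.Language.{u, v}} (T : Set (Fml L)) : Fml L → Prop
  | ax {φ : Fml L} : φ ∈ T → Provable T φ
  | imp_k (φ ψ : Fml L) : Provable T (φ.imp (ψ.imp φ))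
  | imp_s (φ ψ χ : Fml L) :
      Provable T ((φ.imp (ψ.imp χ)).imp ((φ.imp ψ).imp (φ.imp χ)))
  | dne (φ : Fml L) : Provable T (φ.neg.neg.imp φ)
  | all_inst (φ : Fml L) (t : L.Term ℕ) : Provable T (φ.all.imp (φ.inst t))
  | all_imp (φ ψ : Fml L) : Provable T ((φ.imp ψ).all.imp (φ.all.imp ψ.all))
  | all_vac (φ : Fml L) : Provable T (φ.imp (φ.rename Nat.succ).all)
  | eq_refl (t : L.Term ℕ) : Provable T (Fml.equal t t)
  | eq_subst (φ : Fml L) (s t : L.Term ℕ) :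
      Provable T ((Fml.equal s t).imp ((φ.inst s).imp (φ.inst t)))
  | mp {φ ψ : Fml L} : Provable T (φ.imp ψ) → Provable T φ → Provable T ψ
  | gen {φ : Fml L} : Provable T φ → Provable T φ.all

def Consistent {L : FirstOrder.Language.{u, v}} (T : Set (Fml L)) : Prop := ¬ Provable T Fml.falsum

/-! ### Gödel numbering -/

section Coding

variable {L : FirstOrder.Language.{u, v}} [Encodable (Σ k, L.Functions k)] [Encodable (Σ k, L.Relations k)]

/-- The Gödel number of a term. -/
def termCode : L.Term ℕ → ℕ
  | .var i => Nat.pair 0 i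
  | .func (l := k) f ts =>
      Nat.pair 1 (Nat.pair (Encodable.encode (⟨k, f⟩ : Σ k, L.Functions k))
        (Encodable.encode (List.ofFn fun j => termCode (ts j))))

/-- The Gödel number of a formula. -/
def Fml.code : Fml L → ℕ
  | .falsum => Nat.pair 0 0
  | .equal t s => Nat.pair 1 (Nat.pair (termCode t) (termCode s))
  | .rel (k := k) R ts =>
      Nat.pair 2 (Nat.pair (Encodable.encode (⟨k, R⟩ : Σ k, L.Relations k))
        (Encodable.encode (List.ofFn fun j => termCode (ts j))))
  | .imp φ ψ => Nat.pair 3 (Nat.pair φ.code ψ.code)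
  | .all φ => Nat.pair 4 φ.code

end Coding

/-- The symbols of `L` are numbered in such a way that it is decidable whether a number is the
number of a function symbol (relation symbol) of a given arity. -/
structure RecursivelyNumbered (L : FirstOrder.Language.{u, v}) [Encodable (Σ k, L.Functions k)]
    [Encodable (Σ k, L.Relations k)] : Prop where
  func : ComputablePred fun p : ℕ × ℕ =>
    ∃ f : L.Functions p.1, Encodable.encode (⟨p.1, f⟩ : Σ k, L.Functions k) = p.2
  rel : ComputablePred fun p : ℕ × ℕ =>
    ∃ R : L.Relations p.1, Encodable.encode (⟨p.1, R⟩ : Σ k, L.Relations k) = p.2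

/-- A recursively enumerable theory: a set of sentences (axioms) whose Gödel numbers form a
recursively enumerable set. -/
structure IsRETheory {L : FirstOrder.Language.{u, v}} [Encodable (Σ k, L.Functions k)]
    [Encodable (Σ k, L.Relations k)] (T : Set (Fml L)) : Prop where
  sentences : ∀ φ ∈ T, φ.IsSentence
  re : REPred fun c : ℕ => ∃ φ ∈ T, φ.code = c

/-! ### Translations and interpretations -/

/-- A (one-dimensional, parameter-free) translation of the language `L₁` into the language `L₂`.
The arguments of a `k`-ary symbol are the variables `0, …, k - 1`; in `func F` the value of the
function is the variable `k`. -/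
structure Translation (L₁ : FirstOrder.Language.{u, v}) (L₂ : FirstOrder.Language.{u', v'}) where
  dom : Fml L₂
  dom_free : ∀ i ∈ dom.freeVars, i < 1
  eq : Fml L₂
  eq_free : ∀ i ∈ eq.freeVars, i < 2
  func : ∀ {k : ℕ}, L₁.Functions k → Fml L₂
  func_free : ∀ {k : ℕ} (F : L₁.Functions k), ∀ i ∈ (func F).freeVars, i < k + 1
  rel : ∀ {k : ℕ}, L₁.Relations k → Fml L₂
  rel_free : ∀ {k : ℕ} (R : L₁.Relations k), ∀ i ∈ (rel R).freeVars, i < k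

namespace Translation

variable {L₁ : FirstOrder.Language.{u, v}} {L₂ : FirstOrder.Language.{u', v'}} (I : Translation L₁ L₂)

/-- The domain formula applied to the variable `i`. -/
def domAt (i : ℕ) : Fml L₂ := I.dom.rename fun _ => i

/-- The translated equality applied to the variables `i` and `j`. -/
def eqAt (i j : ℕ) : Fml L₂ := I.eq.rename fun m => if m = 0 then i else j

/-- The translation of "the variable `0` is equal to `t`", where the variable `i` of `t` has become
the variable `i + 1`. Nested function symbols are removed by means of bound variables. -/
def trTerm : L₁.Term ℕ → Fml L₂
  | .var i => I.eqAt (i + 1) 0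
  | .func (l := k) F ts =>
      Fml.exs k (Fml.and
        (Fml.conj (List.ofFn fun j : Fin k => Fml.and (I.domAt j)
          ((trTerm (ts j)).rename fun m => Nat.casesOn m (j : ℕ) fun i => i + 1 + k)))
        (I.func F))

/-- The translation `φ^I` of a formula `φ`. -/
def tr : Fml L₁ → Fml L₂
  | .falsum => .falsum
  | .equal t s => Fml.ex (Fml.and (I.domAt 0) (Fml.and (I.trTerm t) (I.trTerm s)))
  | .rel (k := k) R ts =>
      Fml.exs k (Fml.and
        (Fml.conj (List.ofFn fun j : Fin k => Fml.and (I.domAt j)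
          ((I.trTerm (ts j)).rename fun m => Nat.casesOn m (j : ℕ) fun i => i + k)))
        (I.rel R))
  | .imp φ ψ => .imp (tr φ) (tr ψ)
  | .all φ => .all (.imp (I.domAt 0) (tr φ))

/-- For the variables `x = (0, …, k - 1)` and `x' = (k, …, 2k - 1)`: all of them are in the domain,
and `x` and `x'` are equal in the sense of the translation. -/
def argsEq (k : ℕ) : Fml L₂ :=
  Fml.conj (List.ofFn fun j : Fin k =>
    Fml.and (I.domAt j) (Fml.and (I.domAt (k + j)) (I.eqAt j (k + j))))

/-- `I` is an interpretation of the theory `T₁` in the theory `T₂`. -/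
structure IsInterpretation (T₁ : Set (Fml L₁)) (T₂ : Set (Fml L₂)) : Prop where
  /-- the translations of function symbols are total on the domain -/
  total : ∀ {k : ℕ} (F : L₁.Functions k), Provable T₂ (Fml.alls k (Fml.imp
    (Fml.conj (List.ofFn fun j : Fin k => I.domAt j))
    (Fml.ex (Fml.and (I.domAt 0) ((I.func F).rename fun i => if i < k then i + 1 else 0)))))
  /-- the translations of all theorems -/
  theorems : ∀ φ : Fml L₁, φ.IsSentence → Provable T₁ φ → Provable T₂ (I.tr φ)
  /-- the translations of the axioms of equality -/
  eq_refl : Provable T₂ (Fml.alls 1 ((I.domAt 0).imp (I.eqAt 0 0)))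
  eq_symm : Provable T₂ (Fml.alls 2 ((I.domAt 0).imp ((I.domAt 1).imp
    ((I.eqAt 0 1).imp (I.eqAt 1 0)))))
  eq_trans : Provable T₂ (Fml.alls 3 ((I.domAt 0).imp ((I.domAt 1).imp ((I.domAt 2).imp
    ((I.eqAt 0 1).imp ((I.eqAt 1 2).imp (I.eqAt 0 2)))))))
  /-- `x = x' ∧ y = y' ∧ F(x) = y → F(x') = y'` -/
  func_congr : ∀ {k : ℕ} (F : L₁.Functions k), Provable T₂ (Fml.alls (2 * k + 2)
    ((I.argsEq k).imp ((I.domAt (2 * k)).imp ((I.domAt (2 * k + 1)).imp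
      (((I.func F).rename fun i => if i < k then i else 2 * k).imp
        ((I.eqAt (2 * k) (2 * k + 1)).imp
          ((I.func F).rename fun i => if i < k then k + i else 2 * k + 1)))))))
  /-- `x = x' ∧ F(x) = y ∧ F(x') = y' → y = y'` -/
  func_unique : ∀ {k : ℕ} (F : L₁.Functions k), Provable T₂ (Fml.alls (2 * k + 2)
    ((I.argsEq k).imp ((I.domAt (2 * k)).imp ((I.domAt (2 * k + 1)).imp
      (((I.func F).rename fun i => if i < k then i else 2 * k).imp
        (((I.func F).rename fun i => if i < k then k + i else 2 * k + 1).imp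
          (I.eqAt (2 * k) (2 * k + 1))))))))
  /-- `x = x' ∧ R(x) → R(x')` -/
  rel_congr : ∀ {k : ℕ} (R : L₁.Relations k), Provable T₂ (Fml.alls (2 * k)
    ((I.argsEq k).imp ((I.rel R).imp ((I.rel R).rename fun i => k + i))))

/-- The identity translation along an inclusion of languages: all objects are in the domain, and
equality and the symbols are translated as themselves. -/
def ofLHom (e : L₁ →ᴸ L₂) : Translation L₁ L₂ where
  dom := .equal (.var 0) (.var 0)
  dom_free := by
    intro i hi
    simpa [Fml.freeVars, FirstOrder.Language.Term.varFinset] using hi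
  eq := .equal (.var 0) (.var 1)
  eq_free := by
    intro i hi
    simp only [Fml.freeVars, FirstOrder.Language.Term.varFinset, Finset.mem_singleton, Set.mem_ofPred_eq] at hi
    omega
  func {k} F := .equal (.func (e.onFunction F) fun j => .var j) (.var k)
  func_free := by
    intro k F i hi
    simp only [Fml.freeVars, FirstOrder.Language.Term.varFinset, Finset.mem_biUnion, Finset.mem_univ,
      Finset.mem_singleton, true_and, Set.mem_ofPred_eq] at hi
    rcases hi with ⟨j, rfl⟩ | rfl <;> omega
  rel {k} R := .rel (e.onRelation R) fun j => .var j
  rel_free := by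
    intro k R i hi
    simp only [Fml.freeVars, FirstOrder.Language.Term.varFinset, Finset.mem_singleton, Set.mem_ofPred_eq] at hi
    rcases hi with ⟨j, rfl⟩
    exact j.isLt

end Translation

/-! ### The theory of numerals -/

inductive NumFunc : ℕ → Type
  | zero : NumFunc 0
  | succ : NumFunc 1

/-- The language `{0, S}`. -/
def numLang : FirstOrder.Language.{0, 0} := ⟨NumFunc, fun _ => Empty⟩

def zeroSymb : numLang.Functions 0 := NumFunc.zero

def succSymb : numLang.Functions 1 := NumFunc.succ

/-- The numeral of a natural number. -/
def numeral : ℕ → numLang.Term ℕ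
  | 0 => .func zeroSymb Fin.elim0
  | a + 1 => .func succSymb fun _ => numeral a

/-- The theory `Num`. -/
def Num : Set (Fml numLang) :=
  {φ | ∃ a b : ℕ, a ≠ b ∧ φ = (Fml.equal (numeral a) (numeral b)).neg}

section Numerals

variable {L : FirstOrder.Language.{u, v}}

/-- Via `e`, the theory `T` is an extension of `Num` in a language that arises from `{0, S}` by
adding relation symbols only. -/
structure IsRelationalExtension (T : Set (Fml L)) (e : numLang →ᴸ L) : Prop where
  symbols : ∀ k : ℕ, Function.Bijective fun F : numLang.Functions k => e.onFunction F
  extends_num : ∀ a b : ℕ, a ≠ b →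
    Provable T (Fml.equal (e.onTerm (numeral a)) (e.onTerm (numeral b))).neg

/-- `I` is an interpretation of `Num` in `T`; it is the identity if `T` is a relational extension
of `Num`. -/
structure IsNumInterpretation (I : Translation numLang L) (T : Set (Fml L)) : Prop where
  interprets : I.IsInterpretation Num T
  identity : ∀ e : numLang →ᴸ L, IsRelationalExtension T e → I = Translation.ofLHom e

/-- The translation of "the variable `0` is equal to the numeral of `a`", in unnested form:
there are `y₀, …, yₐ₋₁` in the domain with `0_I(y₀)`, `S_I(y₀, y₁)`, …, `S_I(yₐ₋₁, x)`. -/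
def Translation.numeralFml (I : Translation numLang L) : ℕ → Fml L
  | 0 => I.func zeroSymb
  | a + 1 => Fml.ex (Fml.and I.dom (Fml.and (I.numeralFml a) (I.func succSymb)))

/-- Replaces the variables `0, 1, …` of `φ` by the interpreted numerals of the members of the list,
one after the other. The numeral of `a` is not a term of `L`; so it is introduced by
"there is an `x` in the domain that is equal to the numeral of `a`". -/
def Translation.applyList (I : Translation numLang L) : List ℕ → Fml L → Fml L
  | [], φ => φ
  | a :: l, φ => I.applyList l (Fml.ex (Fml.and (Fml.and I.dom (I.numeralFml a)) φ))

/-- The sentence `φ(a₁^I, …, aₙ^I)`; the variables `x₁, …, xₙ` are the de Bruijn indices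
`0, …, n - 1`. -/
def Translation.apply (I : Translation numLang L) {n : ℕ} (φ : Fml L) (a : Fin n → ℕ) : Fml L :=
  I.applyList (List.ofFn a) φ

/-- `φ` strongly separates `M₁ \ M₂` from `M₂ \ M₁` in `T` with respect to `I`. -/
def StronglySeparates (T : Set (Fml L)) (I : Translation numLang L) {n : ℕ} (φ : Fml L)
    (M₁ M₂ : Set (Fin n → ℕ)) : Prop :=
  ∀ a : Fin n → ℕ, (a ∈ M₁ \ M₂ → Provable T (I.apply φ a)) ∧
    (a ∈ M₂ \ M₁ → Provable T (I.apply φ a).neg)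

/-- `φ` exactly separates `M₁` from `M₂` in `T` with respect to `I`. -/
def ExactlySeparates (T : Set (Fml L)) (I : Translation numLang L) {n : ℕ} (φ : Fml L)
    (M₁ M₂ : Set (Fin n → ℕ)) : Prop :=
  ∀ a : Fin n → ℕ, (a ∈ M₁ ↔ Provable T (I.apply φ a)) ∧
    (a ∈ M₂ ↔ Provable T (I.apply φ a).neg)

end Numerals

/-! ### Listings of the recursively enumerable relations and Rosser theories -/

/-- `R 0, R 1, …` is an acceptable listing of all `n`-ary recursively enumerable relations: it is
uniformly recursively enumerable, and an index for each member of a uniformly recursively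
enumerable sequence can be computed. -/
structure IsAcceptableListing {n : ℕ} (R : ℕ → Set (Fin n → ℕ)) : Prop where
  re : REPred fun p : ℕ × (Fin n → ℕ) => p.2 ∈ R p.1
  index : ∀ S : ℕ → Set (Fin n → ℕ), (REPred fun p : ℕ × (Fin n → ℕ) => p.2 ∈ S p.1) →
    ∃ h : ℕ → ℕ, Computable h ∧ ∀ i, R (h i) = S i

variable {L : FirstOrder.Language.{u, v}} [Encodable (Σ k, L.Functions k)] [Encodable (Σ k, L.Relations k)]

/-- `T` is effectively `n`-Rosser (`R` is the listing of the `n`-ary r.e. relations). -/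
def EffectivelyRosser {n : ℕ} (R : ℕ → Set (Fin n → ℕ)) (T : Set (Fml L)) : Prop :=
  ∃ I : Translation numLang L, IsNumInterpretation I T ∧
    ∃ f : ℕ → ℕ → ℕ, Computable₂ f ∧ ∀ i j : ℕ,
      ∃ φ : Fml L, φ.freeVars = {m | m < n} ∧ φ.code = f i j ∧
        StronglySeparates T I φ (R i) (R j)

/-- `T` is effectively exact `n`-Rosser (`R` is the listing of the `n`-ary r.e. relations). -/
def EffectivelyExactRosser {n : ℕ} (R : ℕ → Set (Fin n → ℕ)) (T : Set (Fml L)) : Prop :=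
  ∃ I : Translation numLang L, IsNumInterpretation I T ∧
    ∃ f : ℕ → ℕ → ℕ, Computable₂ f ∧ ∀ i j : ℕ, Disjoint (R i) (R j) →
      ∃ φ : Fml L, φ.freeVars = {m | m < n} ∧ φ.code = f i j ∧
        ExactlySeparates T I φ (R i) (R j)

end Rosser

/-! ### Recursively enumerable predicates -/

section Computability

attribute [fun_prop] Primrec Primrec.id Primrec.const Primrec.comp Primrec.pair Primrec.fst
  Primrec.snd Primrec.encode Primrec.succ Primrec.unpair
attribute [fun_prop] Computable Computable.id Computable.const Computable.comp Computable.pair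
  Computable.fst Computable.snd Computable.encode Computable.succ Computable.unpair Primrec.to_comp

variable {α β γ : Type*} [Primcodable α] [Primcodable β] [Primcodable γ]

/-! Rosser to exact Rosser is a self-reference argument. Given disjoint `R i` and `R j`, the double
recursion theorem yields indices `h` and `k`, computable from `i` and `j`, such that for the formula
φ numbered `f h k` the relation `R h` is `R i` together with all tuples at which T refutes φ, and `R
k` is `R j` together with all tuples at which T proves φ. The crossing is the point. If a tuple of
`R i` had no proof, it would lie in `R h` but not in `R k`, and separation would supply a proof. If
a tuple outside `R i` had a proof, then by consistency it would lie in `R k` but not in `R h`, so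
separation would also supply a refutation. The other side is symmetric (`EffectivelyRosser.exact`,
`IsAcceptableListing.exists_fixed_point`).

The converse uses the reduction principle: `R i` and `R j` are replaced, uniformly, by disjoint RE
relations that contain the two differences (`REPred.reduction`).

The self-reference needs provability of φ at a tuple to be RE in the number of φ and the tuple
(`exists_rePred_apply`). For this the calculus is read as a system of rules on numbers, and the
least predicate closed under an RE set of rules is RE (`REPred.generated`). The same lemma treats
substitution, described by its graph, so no syntactic operation has to be written as a recursive
function on codes. -/

@[fun_prop]
theorem primrec_natPair {f g : α → ℕ} (hf : Primrec f) (hg : Primrec g) :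
    Primrec fun a => Nat.pair (f a) (g a) :=
  Primrec₂.natPair.comp hf hg

@[fun_prop]
theorem computable_natPair {f g : α → ℕ} (hf : Computable f) (hg : Computable g) :
    Computable fun a => Nat.pair (f a) (g a) :=
  Primrec₂.natPair.to_comp.comp hf hg

@[fun_prop]
theorem primrec_cons {f : α → β} {g : α → List β} (hf : Primrec f) (hg : Primrec g) :
    Primrec fun a => f a :: g a :=
  Primrec.list_cons.comp hf hg

@[fun_prop]
theorem primrec_map {f : α → List β} {g : α → β → γ} (hf : Primrec f)
    (hg : Primrec fun p : α × β => g p.1 p.2) : Primrec fun a => (f a).map (g a) :=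
  Primrec.list_map hf hg

@[fun_prop]
theorem primrec_length {f : α → List β} (hf : Primrec f) : Primrec fun a => (f a).length :=
  Primrec.list_length.comp hf

/-- A predicate is recursively enumerable iff it is the projection of a primitive recursive
predicate. -/
theorem rePred_iff_exists_primrec {p : α → Prop} :
    REPred p ↔ ∃ q : α × ℕ → Bool, Primrec q ∧ ∀ a, p a ↔ ∃ n, q (a, n) = true := by
  constructor
  · intro h
    obtain ⟨c, hc⟩ := Nat.Partrec.Code.exists_code.1 h
    -- The witness is a bound on the running time of the program `c`.
    refine ⟨fun x => (Nat.Partrec.Code.evaln x.2 c (Encodable.encode x.1)).isSome,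
      Primrec.option_isSome.comp (Nat.Partrec.Code.primrec_evaln.comp
        (g := fun x : α × ℕ => ((x.2, c), Encodable.encode x.1)) (by fun_prop)), fun a => ?_⟩
    have h1 := congrFun hc (Encodable.encode a)
    simp only [Encodable.encodek, Part.coe_some, Part.bind_some] at h1
    have h2 : p a ↔ (c.eval (Encodable.encode a)).Dom := by
      rw [h1]; simp [Part.assert]
    rw [h2, Part.dom_iff_mem]
    constructor
    · rintro ⟨y, hy⟩
      obtain ⟨k, hk⟩ := Nat.Partrec.Code.evaln_complete.1 hy
      exact ⟨k, Option.isSome_iff_exists.2 ⟨y, hk⟩⟩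
    · rintro ⟨k, hk⟩
      obtain ⟨y, hy⟩ := Option.isSome_iff_exists.1 hk
      exact ⟨y, Nat.Partrec.Code.evaln_sound hy⟩
  · rintro ⟨q, hq, hp⟩
    have h : Partrec fun a => Nat.rfind fun n => Part.some (q (a, n)) :=
      Partrec.rfind (p := fun a n => Part.some (q (a, n))) hq.to_comp.partrec
    refine h.dom_re.of_eq fun a => ?_
    rw [hp]
    refine Nat.rfind_dom'.trans ?_
    simp

namespace REPred

theorem comp {p : β → Prop} (hp : REPred p) {f : α → β} (hf : Computable f) :
    REPred fun a => p (f a) :=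
  Partrec.comp hp hf

theorem and {p q : α → Prop} (hp : REPred p) (hq : REPred q) : REPred fun a => p a ∧ q a := by
  obtain ⟨P, hP, hp⟩ := rePred_iff_exists_primrec.1 hp
  obtain ⟨Q, hQ, hq⟩ := rePred_iff_exists_primrec.1 hq
  refine rePred_iff_exists_primrec.2 ⟨fun x => P (x.1, x.2.unpair.1) && Q (x.1, x.2.unpair.2),
    Primrec.and.comp (hP.comp (by fun_prop)) (hQ.comp (by fun_prop)), fun a => ?_⟩
  rw [hp, hq]
  constructor
  · rintro ⟨⟨m, hm⟩, n, hn⟩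
    exact ⟨Nat.pair m n, by simp [hm, hn]⟩
  · rintro ⟨n, hn⟩
    rw [Bool.and_eq_true] at hn
    exact ⟨⟨_, hn.1⟩, _, hn.2⟩

theorem or {p q : α → Prop} (hp : REPred p) (hq : REPred q) : REPred fun a => p a ∨ q a := by
  obtain ⟨P, hP, hp⟩ := rePred_iff_exists_primrec.1 hp
  obtain ⟨Q, hQ, hq⟩ := rePred_iff_exists_primrec.1 hq
  refine rePred_iff_exists_primrec.2 ⟨fun x => P x || Q x, Primrec.or.comp hP hQ, fun a => ?_⟩
  rw [hp, hq, ← exists_or]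
  simp

theorem exists_snd {p : α × β → Prop} (hp : REPred p) : REPred fun a => ∃ b, p (a, b) := by
  obtain ⟨P, hP, hp⟩ := rePred_iff_exists_primrec.1 hp
  -- One number carries both the code of `b` and the witness for it; a number whose first component
  -- codes no `b` counts as failure.
  refine rePred_iff_exists_primrec.2 ⟨fun x =>
    ((Encodable.decode (α := β) x.2.unpair.1).map fun b => P ((x.1, b), x.2.unpair.2)).getD false,
    Primrec.option_getD.comp (Primrec.option_map (Primrec.decode.comp (by fun_prop))
      (hP.comp (by fun_prop))) (by fun_prop), fun a => ?_⟩
  constructor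
  · rintro ⟨b, hb⟩
    obtain ⟨n, hn⟩ := (hp _).1 hb
    exact ⟨Nat.pair (Encodable.encode b) n, by simp [hn]⟩
  · rintro ⟨n, hn⟩
    cases h : Encodable.decode (α := β) n.unpair.1 with
    | none => simp [h] at hn
    | some b =>
      simp only [h, Option.map_some, Option.getD_some] at hn
      exact ⟨b, (hp _).2 ⟨_, hn⟩⟩

theorem eq {f g : α → β} (hf : Computable f) (hg : Computable g) : REPred fun a => f a = g a := by
  classical
  have h : PrimrecPred fun x : β × β => x.1 = x.2 := Primrec.eq.comp Primrec.fst Primrec.snd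
  exact h.computablePred.to_re.comp (hf.pair hg)

theorem image {p : β → Prop} (hp : REPred p) {f : β → α} (hf : Computable f) :
    REPred fun a => ∃ b, p b ∧ f b = a :=
  exists_snd (p := fun x : α × β => p x.2 ∧ f x.2 = x.1)
    ((hp.comp (by fun_prop)).and (eq (hf.comp (by fun_prop)) (by fun_prop)))

theorem range {f : β → α} (hf : Computable f) : REPred fun a => ∃ b, f b = a :=
  exists_snd (p := fun x : α × β => f x.2 = x.1) (eq (hf.comp (by fun_prop)) (by fun_prop))

end REPred

/-- The least predicate closed under the given rules, each consisting of a list of premises and a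
conclusion. -/
inductive Generated (rule : List α × α → Prop) : α → Prop
  | intro {l : List α} {a : α} : rule (l, a) → (∀ b ∈ l, Generated rule b) → Generated rule a

/-- A derivation can be linearised into a finite list of rule applications, each paired with a
witness that it is a rule. Replaying such a list is primitive recursive, so derivability is a search
over lists. -/
theorem REPred.generated {rule : List α × α → Prop} (h : REPred rule) :
    REPred (Generated rule) := by
  classical
  obtain ⟨q, hq, hrule⟩ := rePred_iff_exists_primrec.1 h
  -- An entry with a wrong witness or a premise not yet derived is skipped, so every list is a legal
  -- input. The tail is replayed before the head.
  let step : (List α × α) × ℕ → List α → List α := fun x acc =>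
    if q x = true ∧ ∀ b ∈ x.1.1, b ∈ acc then x.1.2 :: acc else acc
  let run : List ((List α × α) × ℕ) → List α := fun w => w.foldr step []
  have hmem : PrimrecRel fun (b : α) (l : List α) => b ∈ l := by
    have : PrimrecRel fun (l : List α) (b : α) => ∃ a ∈ l, a = b := Primrec.eq.exists_mem_list
    exact this.swap.of_eq fun a l => by simp [Function.swap]
  have hstep : Primrec fun y : ((List α × α) × ℕ) × List α => step y.1 y.2 := by
    refine Primrec.ite (PrimrecPred.and ?_ ?_) (by fun_prop) (by fun_prop)
    · exact Primrec.eq.comp (hq.comp (by fun_prop)) (by fun_prop)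
    · exact hmem.forall_mem_list.comp (f := fun y : ((List α × α) × ℕ) × List α => y.1.1.1)
        (by fun_prop) (by fun_prop)
  have hrun : Primrec run :=
    Primrec.list_foldr (h := fun _ y => step y.1 y.2) Primrec.id (Primrec.const [])
      (hstep.comp Primrec.snd)
  have sound : ∀ w, ∀ a ∈ run w, Generated rule a := by
    intro w
    induction w with
    | nil => intro a ha; simp [run] at ha
    | cons x w ih =>
      intro a ha
      change a ∈ step x (run w) at ha
      by_cases hx : q x = true ∧ ∀ b ∈ x.1.1, b ∈ run w
      · simp only [step, if_pos hx, List.mem_cons] at ha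
        rcases ha with rfl | ha
        · exact .intro ((hrule x.1).2 ⟨x.2, hx.1⟩) fun b hb => ih b (hx.2 b hb)
        · exact ih a ha
      · simp only [step, if_neg hx] at ha
        exact ih a ha
  -- Extending an arbitrary earlier list `w` lets the derivations of the several premises be stacked
  -- without losing what was derived before.
  have complete : ∀ a, Generated rule a → ∀ w, ∃ w', run w ⊆ run w' ∧ a ∈ run w' := by
    intro a ha
    induction ha with
    | @intro l a hla _ ih =>
      intro w
      have key : ∀ m : List α, m ⊆ l → ∃ w', run w ⊆ run w' ∧ m ⊆ run w' := by
        intro m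
        induction m with
        | nil => exact fun _ => ⟨w, List.Subset.refl _, List.nil_subset _⟩
        | cons b m ihm =>
          intro hm
          obtain ⟨w₁, h₁, h₁'⟩ := ihm fun c hc => hm (List.mem_cons_of_mem _ hc)
          obtain ⟨w₂, h₂, h₂'⟩ := ih b (hm List.mem_cons_self) w₁
          exact ⟨w₂, List.Subset.trans h₁ h₂, List.cons_subset.2 ⟨h₂', List.Subset.trans h₁' h₂⟩⟩
      obtain ⟨w', hw, hl⟩ := key l (List.Subset.refl _)
      obtain ⟨n, hn⟩ := (hrule _).1 hla
      refine ⟨((l, a), n) :: w', ?_⟩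
      have : run (((l, a), n) :: w') = a :: run w' :=
        if_pos (⟨hn, fun b hb => hl hb⟩ : q ((l, a), n) = true ∧ ∀ b ∈ l, b ∈ run w')
      rw [this]
      exact ⟨List.Subset.trans hw (List.subset_cons_self _ _), List.mem_cons_self⟩
  have hex : REPred fun a => ∃ w, a ∈ run w := by
    refine REPred.exists_snd (p := fun x : α × List ((List α × α) × ℕ) => x.1 ∈ run x.2) ?_
    exact (hmem.comp (f := fun x : α × List ((List α × α) × ℕ) => x.1) (by fun_prop)
      (hrun.comp Primrec.snd)).computablePred.to_re
  refine hex.of_eq fun a => ⟨fun ⟨w, hw⟩ => sound w a hw, fun ha => ?_⟩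
  obtain ⟨w, -, hw⟩ := complete a ha []
  exact ⟨w, hw⟩

/-- Disjoint recursively enumerable predicates reducing a given pair. -/
theorem REPred.reduction {p q : α → Prop} (hp : REPred p) (hq : REPred q) :
    ∃ p' q' : α → Prop, REPred p' ∧ REPred q' ∧ (∀ a, ¬ (p' a ∧ q' a)) ∧
      (∀ a, p a → ¬ q a → p' a) ∧ ∀ a, q a → ¬ p a → q' a := by
  have hf : Partrec fun a => Part.assert (p a) fun _ => Part.some true :=
    (Partrec.map hp (Computable.const true).to₂).of_eq fun a => by
      ext b; simp [Part.mem_assert_iff]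
  have hg : Partrec fun a => Part.assert (q a) fun _ => Part.some false :=
    (Partrec.map hq (Computable.const false).to₂).of_eq fun a => by
      ext b; simp [Part.mem_assert_iff]
  -- `k` merges the two semi-decision procedures and returns the answer of one that halts: `true`
  -- for `p`, `false` for `q`. Having a single value gives disjointness; where only one of `p` and
  -- `q` holds, the answer is forced.
  obtain ⟨k, hk, hkfg⟩ := Partrec.merge' hf hg
  have hval : ∀ b, REPred fun a => b ∈ k a := by
    intro b
    have h := Partrec.bind hk (g := fun _ c => Part.assert (c = b) fun _ => Part.some ()) ?_
    · refine h.dom_re.of_eq fun a => ?_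
      simp only [Part.dom_iff_mem, Part.mem_bind_iff, Part.mem_assert_iff]
      constructor
      · rintro ⟨_, c, hc, rfl, _⟩; exact hc
      · exact fun hb => ⟨(), b, hb, rfl, by simp⟩
    · exact REPred.eq (α := α × Bool) (f := fun x => x.2) (g := fun _ => b) (by fun_prop)
        (by fun_prop)
  refine ⟨_, _, hval true, hval false, fun a h => ?_, fun a ha hb => ?_, fun a ha hb => ?_⟩
  · exact Bool.noConfusion (Part.mem_unique h.1 h.2)
  · obtain ⟨x, hx⟩ := Part.dom_iff_mem.1 ((hkfg a).2.2 (Or.inl (by simpa [Part.assert] using ha)))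
    have := (hkfg a).1 x hx
    simp only [Part.mem_assert_iff, Part.mem_some_iff] at this
    rcases this with ⟨_, rfl⟩ | ⟨h, _⟩
    · exact hx
    · exact absurd h hb
  · obtain ⟨x, hx⟩ := Part.dom_iff_mem.1 ((hkfg a).2.2 (Or.inr (by simpa [Part.assert] using ha)))
    have := (hkfg a).1 x hx
    simp only [Part.mem_assert_iff, Part.mem_some_iff] at this
    rcases this with ⟨h, _⟩ | ⟨_, rfl⟩
    · exact absurd h hb
    · exact hx

end Computability

namespace Rosser

open FirstOrder.Language (Term)

/-! ### Gödel numbers of terms and formulas, and substitution on them -/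

section Substitution

set_option linter.unusedSectionVars false

variable {L : FirstOrder.Language.{u, v}}

theorem relabel_eq_subst (t : L.Term ℕ) (ρ : ℕ → ℕ) :
    t.relabel ρ = t.subst fun i => Term.var (ρ i) := by
  induction t with
  | var => rfl
  | func f ts ih => simp [Term.relabel, Term.subst, ih]

variable [Encodable (Σ k, L.Functions k)]

theorem termCode_injective : Function.Injective (termCode (L := L)) := by
  intro t
  induction t with
  | var i =>
    intro s h
    cases s <;> simp_all [termCode]
  | @func k f ts ih =>
    intro s h
    cases s with
    | var => simp [termCode] at h
    | @func m g ss =>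
      simp only [termCode, Nat.pair_eq_pair, true_and, Encodable.encode_inj] at h
      obtain ⟨h₁, h₂⟩ := h
      cases h₁
      rw [List.ofFn_inj] at h₂
      congr 1
      exact funext fun j => ih j (congrFun h₂ j)

variable [Encodable (Σ k, L.Relations k)]

theorem code_injective : Function.Injective (Fml.code (L := L)) := by
  intro φ
  induction φ with
  | falsum =>
    intro ψ h
    cases ψ <;> simp_all [Fml.code]
  | equal t s =>
    intro ψ h
    cases ψ <;> simp_all [Fml.code, termCode_injective.eq_iff]
  | @rel k Q ts =>
    intro ψ h
    cases ψ with
    | @rel m Q' ss =>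
      simp only [Fml.code, Nat.pair_eq_pair, true_and, Encodable.encode_inj] at h
      obtain ⟨h₁, h₂⟩ := h
      cases h₁
      rw [List.ofFn_inj] at h₂
      congr 1
      exact funext fun j => termCode_injective (congrFun h₂ j)
    | _ => simp [Fml.code] at h
  | imp φ χ ih₁ ih₂ =>
    intro ψ h
    cases ψ with
    | imp φ' χ' =>
      simp only [Fml.code, Nat.pair_eq_pair, true_and] at h
      rw [ih₁ h.1, ih₂ h.2]
    | _ => simp [Fml.code] at h
  | all φ ih =>
    intro ψ h
    cases ψ with
    | all φ' =>
      simp only [Fml.code, Nat.pair_eq_pair, true_and] at h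
      rw [ih h]
    | _ => simp [Fml.code] at h

/-- `F` is the number of a function symbol of arity `k`, for `(k, F)`. -/
def IsFuncCode (L : FirstOrder.Language.{u, v}) [Encodable (Σ k, L.Functions k)] (p : ℕ × ℕ) : Prop :=
  ∃ f : L.Functions p.1, Encodable.encode (⟨p.1, f⟩ : Σ k, L.Functions k) = p.2

/-- `R` is the number of a relation symbol of arity `k`, for `(k, R)`. -/
def IsRelCode (L : FirstOrder.Language.{u, v}) [Encodable (Σ k, L.Relations k)] (p : ℕ × ℕ) : Prop :=
  ∃ R : L.Relations p.1, Encodable.encode (⟨p.1, R⟩ : Σ k, L.Relations k) = p.2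

section Graph

variable {π : Type*}

/-- The judgements of the calculus generating the graph of substitution on Gödel numbers: `(b, p, c, d)`
says that the substitution described by `p` maps the term (if `b` is `false`) or formula
(if `b` is `true`) with number `c` to the one with number `d`. -/
abbrev SubstJudgement (π : Type*) := Bool × π × ℕ × ℕ

variable (L) in
/-- The rules generating the graph of substitution on Gödel numbers. The substitution described
by `p` maps the variable `i` to the term with number `v (p, i)`, and `lift (p, p')` says that
`p'` describes the substitution pushed under a quantifier. -/
def SubstRule (v : π × ℕ → ℕ) (lift : π × π → Prop)
    (x : List (SubstJudgement π) × SubstJudgement π) : Prop :=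
  (∃ w : π × ℕ, ([], false, w.1, Nat.pair 0 w.2, v w) = x) ∨
  (∃ w : π × ℕ × List (ℕ × ℕ), IsFuncCode L (w.2.2.length, w.2.1) ∧
    (w.2.2.map (fun y => (false, w.1, y)), false, w.1,
      Nat.pair 1 (Nat.pair w.2.1 (Encodable.encode (w.2.2.map fun y => y.1))),
      Nat.pair 1 (Nat.pair w.2.1 (Encodable.encode (w.2.2.map fun y => y.2)))) = x) ∨
  (∃ w : π, ([], true, w, Nat.pair 0 0, Nat.pair 0 0) = x) ∨
  (∃ w : π × (ℕ × ℕ) × (ℕ × ℕ), ([(false, w.1, w.2.1), (false, w.1, w.2.2)], true, w.1,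
    Nat.pair 1 (Nat.pair w.2.1.1 w.2.2.1), Nat.pair 1 (Nat.pair w.2.1.2 w.2.2.2)) = x) ∨
  (∃ w : π × ℕ × List (ℕ × ℕ), IsRelCode L (w.2.2.length, w.2.1) ∧
    (w.2.2.map (fun y => (false, w.1, y)), true, w.1,
      Nat.pair 2 (Nat.pair w.2.1 (Encodable.encode (w.2.2.map fun y => y.1))),
      Nat.pair 2 (Nat.pair w.2.1 (Encodable.encode (w.2.2.map fun y => y.2)))) = x) ∨
  (∃ w : π × (ℕ × ℕ) × (ℕ × ℕ), ([(true, w.1, w.2.1), (true, w.1, w.2.2)], true, w.1,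
    Nat.pair 3 (Nat.pair w.2.1.1 w.2.2.1), Nat.pair 3 (Nat.pair w.2.1.2 w.2.2.2)) = x) ∨
  (∃ w : (π × π) × (ℕ × ℕ), lift w.1 ∧
    ([(true, w.1.2, w.2)], true, w.1.1, Nat.pair 4 w.2.1, Nat.pair 4 w.2.2) = x)

variable (L) in
/-- The graph of substitution on Gödel numbers. -/
def SubstGraph (v : π × ℕ → ℕ) (lift : π × π → Prop) : SubstJudgement π → Prop :=
  Generated (SubstRule L v lift)

theorem SubstGraph.rePred [Primcodable π] (hL : RecursivelyNumbered L) {v : π × ℕ → ℕ} {lift : π × π → Prop}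
    (hv : Primrec v) (hlift : REPred lift) : REPred (SubstGraph L v lift) := by
  have hf : REPred (IsFuncCode L) := hL.func.to_re
  have hr : REPred (IsRelCode L) := hL.rel.to_re
  refine REPred.generated ?_
  refine .or (.range ?_) <| .or (.image (hf.comp ?_) ?_) <| .or (.range ?_) <| .or (.range ?_) <|
    .or (.image (hr.comp ?_) ?_) <| .or (.range ?_) (.image (hlift.comp ?_) ?_) <;>
  exact Primrec.to_comp (by fun_prop)

/-- The parameter `p` describes the substitution `σ`. -/
def Describes (v : π × ℕ → ℕ) (p : π) (σ : ℕ → L.Term ℕ) : Prop :=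
  ∀ i, termCode (σ i) = v (p, i)

theorem exists_forall_get {δ : Type*} {l : List (ℕ × ℕ)} {P : δ → ℕ × ℕ → Prop}
    (h : ∀ y ∈ l, ∃ t, P t y) : ∃ ts : Fin l.length → δ, ∀ j, P (ts j) (l.get j) :=
  Classical.axiomOfChoice fun j => h _ (List.get_mem l j)

/-- What a derivable judgement says. -/
def SubstSound (L : FirstOrder.Language.{u, v}) [Encodable (Σ k, L.Functions k)]
    [Encodable (Σ k, L.Relations k)] (v : π × ℕ → ℕ) : SubstJudgement π → Prop
  | (false, p, y) => ∃ t : L.Term ℕ, termCode t = y.1 ∧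
      ∀ σ : ℕ → L.Term ℕ, Describes v p σ → termCode (t.subst σ) = y.2
  | (true, p, y) => ∃ φ : Fml L, φ.code = y.1 ∧
      ∀ σ : ℕ → L.Term ℕ, Describes v p σ → (φ.subst σ).code = y.2

/-- Induction on the derivation. The claim quantifies over all σ described by the parameter, so that
under a quantifier it can be applied to `Fml.up σ`, which the lifted parameter describes. -/
theorem SubstGraph.sound {v : π × ℕ → ℕ} {lift : π × π → Prop}
    (hlift : ∀ p p', lift (p, p') → ∀ σ : ℕ → L.Term ℕ, Describes v p σ → Describes v p' (Fml.up σ))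
    {x : SubstJudgement π} (hx : SubstGraph L v lift x) : SubstSound L v x := by
  induction hx with
  | @intro l x h _ ih =>
    rcases h with ⟨w, h⟩ | ⟨⟨p, F, l'⟩, hF, h⟩ | ⟨p, h⟩ | ⟨⟨p, y, z⟩, h⟩ | ⟨⟨p, F, l'⟩, hF, h⟩ |
      ⟨⟨p, y, z⟩, h⟩ | ⟨⟨⟨p, p'⟩, y⟩, hp, h⟩ <;> cases h
    · exact ⟨.var w.2, rfl, fun σ hσ => hσ w.2⟩
    · obtain ⟨f, rfl⟩ : ∃ f : L.Functions l'.length,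
          Encodable.encode (⟨_, f⟩ : Σ k, L.Functions k) = F := hF
      obtain ⟨ts, hts⟩ := exists_forall_get (l := l')
        (P := fun (t : L.Term ℕ) y => termCode t = y.1 ∧ ∀ σ : ℕ → L.Term ℕ, Describes v p σ →
          termCode (t.subst σ) = y.2) fun y hy => ih _ (List.mem_map_of_mem hy)
      refine ⟨.func f ts, ?_, fun σ hσ => ?_⟩
      · simp only [termCode, fun j => (hts j).1]
        congr 3
        exact List.ext_getElem (by simp) (by simp)
      · simp only [termCode, Term.subst, fun j => (hts j).2 σ hσ]
        congr 3
        exact List.ext_getElem (by simp) (by simp)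
    · exact ⟨.falsum, rfl, fun _ _ => rfl⟩
    · obtain ⟨t, ht, ht'⟩ := ih (false, p, y) (by simp)
      obtain ⟨s, hs, hs'⟩ := ih (false, p, z) (by simp)
      exact ⟨.equal t s, by simp [Fml.code, ht, hs],
        fun σ hσ => by simp [Fml.code, Fml.subst, ht' σ hσ, hs' σ hσ]⟩
    · obtain ⟨f, rfl⟩ : ∃ f : L.Relations l'.length,
          Encodable.encode (⟨_, f⟩ : Σ k, L.Relations k) = F := hF
      obtain ⟨ts, hts⟩ := exists_forall_get (l := l')
        (P := fun (t : L.Term ℕ) y => termCode t = y.1 ∧ ∀ σ : ℕ → L.Term ℕ, Describes v p σ →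
          termCode (t.subst σ) = y.2) fun y hy => ih _ (List.mem_map_of_mem hy)
      refine ⟨.rel f ts, ?_, fun σ hσ => ?_⟩
      · simp only [Fml.code, fun j => (hts j).1]
        congr 3
        exact List.ext_getElem (by simp) (by simp)
      · simp only [Fml.code, Fml.subst, fun j => (hts j).2 σ hσ]
        congr 3
        exact List.ext_getElem (by simp) (by simp)
    · obtain ⟨φ, ht, ht'⟩ := ih (true, p, y) (by simp)
      obtain ⟨ψ, hs, hs'⟩ := ih (true, p, z) (by simp)
      exact ⟨.imp φ ψ, by simp [Fml.code, ht, hs],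
        fun σ hσ => by simp [Fml.code, Fml.subst, ht' σ hσ, hs' σ hσ]⟩
    · obtain ⟨φ, ht, ht'⟩ := ih (true, p', y) (by simp)
      exact ⟨.all φ, by simp [Fml.code, ht],
        fun σ hσ => by simp [Fml.code, Fml.subst, ht' _ (hlift p p' hp σ hσ)]⟩

theorem SubstGraph.term (v : π × ℕ → ℕ) (lift : π × π → Prop) {p : π} {σ : ℕ → L.Term ℕ}
    (hσ : Describes v p σ) (t : L.Term ℕ) :
    SubstGraph L v lift (false, p, termCode t, termCode (t.subst σ)) := by
  induction t with
  | var i =>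
    refine .intro (l := []) (.inl ⟨(p, i), ?_⟩) (by simp)
    simp [termCode, Term.subst, hσ i]
  | @func k f ts ih =>
    let l : List (ℕ × ℕ) := List.ofFn fun j => (termCode (ts j), termCode ((ts j).subst σ))
    refine .intro (l := l.map fun y => (false, p, y))
      (.inr (.inl ⟨(p, Encodable.encode (⟨k, f⟩ : Σ k, L.Functions k), l), ?_, ?_⟩)) ?_
    · have : l.length = k := List.length_ofFn
      change IsFuncCode L (l.length, _)
      rw [this]
      exact ⟨f, rfl⟩
    · simp [termCode, Term.subst, l, List.map_ofFn, Function.comp_def]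
    · intro b hb
      simp only [l, List.mem_map, List.mem_ofFn] at hb
      obtain ⟨_, ⟨j, rfl⟩, rfl⟩ := hb
      exact ih j

/-- Completeness of the graph. A quantifier changes both the parameter and the substitution; all
that is needed is that some lifted parameter describes the new one. -/
theorem SubstGraph.fml {v : π × ℕ → ℕ} {lift : π × π → Prop}
    (hlift : ∀ p, ∀ σ : ℕ → L.Term ℕ, Describes v p σ →
      ∃ p', lift (p, p') ∧ Describes v p' (Fml.up σ))
    {p : π} {σ : ℕ → L.Term ℕ} (hσ : Describes v p σ) (φ : Fml L) :
    SubstGraph L v lift (true, p, φ.code, (φ.subst σ).code) := by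
  induction φ generalizing p σ with
  | falsum => exact .intro (l := []) (.inr (.inr (.inl ⟨p, rfl⟩))) (by simp)
  | equal t s =>
    refine .intro (.inr (.inr (.inr (.inl ⟨(p, (termCode t, termCode (t.subst σ)),
      (termCode s, termCode (s.subst σ))), rfl⟩)))) ?_
    simpa using ⟨SubstGraph.term v lift hσ t, SubstGraph.term v lift hσ s⟩
  | @rel k Q ts =>
    let l : List (ℕ × ℕ) := List.ofFn fun j => (termCode (ts j), termCode ((ts j).subst σ))
    refine .intro (l := l.map fun y => (false, p, y)) (.inr (.inr (.inr (.inr (.inl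
      ⟨(p, Encodable.encode (⟨k, Q⟩ : Σ k, L.Relations k), l), ?_, ?_⟩))))) ?_
    · have : l.length = k := List.length_ofFn
      change IsRelCode L (l.length, _)
      rw [this]
      exact ⟨Q, rfl⟩
    · simp [Fml.code, Fml.subst, l, List.map_ofFn, Function.comp_def]
    · intro b hb
      simp only [l, List.mem_map, List.mem_ofFn] at hb
      obtain ⟨_, ⟨j, rfl⟩, rfl⟩ := hb
      exact SubstGraph.term v lift hσ (ts j)
  | imp φ ψ ih₁ ih₂ =>
    refine .intro (.inr (.inr (.inr (.inr (.inr (.inl ⟨(p, (φ.code, (φ.subst σ).code),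
      (ψ.code, (ψ.subst σ).code)), rfl⟩)))))) ?_
    simpa using ⟨ih₁ hσ, ih₂ hσ⟩
  | all φ ih =>
    obtain ⟨p', hp, hσ'⟩ := hlift p σ hσ
    refine .intro (.inr (.inr (.inr (.inr (.inr (.inr ⟨((p, p'),
      (φ.code, (φ.subst (Fml.up σ)).code)), hp, rfl⟩)))))) ?_
    simpa using! ih hσ'

end Graph

/-! The two substitutions used by the calculus: the successor renaming and the instances. -/

/-- Numbers of the terms of the substitution that renames every variable `i ≥ k` to `i + 1`. -/
def shiftVal (p : ℕ × ℕ) : ℕ := Nat.pair 0 (if p.2 < p.1 then p.2 else p.2 + 1)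

variable (L) in
def ShiftGraph : SubstJudgement ℕ → Prop := SubstGraph L shiftVal fun p => p.1.succ = p.2

/-- Numbers of the terms of the substitution that replaces the variable `k` by the term with
number `c` and renames every variable `i > k` to `i - 1`, for `((k, c), i)`. -/
def instVal (p : (ℕ × ℕ) × ℕ) : ℕ :=
  if p.2 = p.1.1 then p.1.2 else Nat.pair 0 (if p.2 < p.1.1 then p.2 else p.2 - 1)

-- Under a quantifier the threshold grows by one and the inserted term is shifted. The shift is
-- itself available only as an RE graph, which is why lifting is a relation and not a function.
variable (L) in
def InstLift (q : (ℕ × ℕ) × (ℕ × ℕ)) : Prop :=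
  q.1.1.succ = q.2.1 ∧ ShiftGraph L (false, 0, q.1.2, q.2.2)

variable (L) in
def InstGraph : SubstJudgement (ℕ × ℕ) → Prop := SubstGraph L instVal (InstLift L)

theorem primrec_shiftVal : Primrec shiftVal :=
  primrec_natPair (Primrec.const 0) (Primrec.ite (Primrec.nat_lt.comp Primrec.snd Primrec.fst)
    Primrec.snd (Primrec.succ.comp Primrec.snd))

theorem primrec_instVal : Primrec instVal :=
  Primrec.ite (Primrec.eq.comp (f := fun p : (ℕ × ℕ) × ℕ => p.2) (g := fun p => p.1.1)
      (by fun_prop) (by fun_prop)) (by fun_prop)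
    (primrec_natPair (Primrec.const 0)
      (Primrec.ite (Primrec.nat_lt.comp (f := fun p : (ℕ × ℕ) × ℕ => p.2) (g := fun p => p.1.1)
        (by fun_prop) (by fun_prop)) Primrec.snd (Primrec.pred.comp Primrec.snd)))

theorem ShiftGraph.rePred (hL : RecursivelyNumbered L) : REPred (ShiftGraph L) :=
  SubstGraph.rePred hL primrec_shiftVal (.eq (by fun_prop) (by fun_prop))

theorem InstGraph.rePred (hL : RecursivelyNumbered L) : REPred (InstGraph L) :=
  SubstGraph.rePred hL primrec_instVal
    (.and (.eq (by fun_prop) (by fun_prop)) ((ShiftGraph.rePred hL).comp (by fun_prop)))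

theorem describes_shift_up (k : ℕ) (σ : ℕ → L.Term ℕ) (h : Describes shiftVal k σ) :
    Describes shiftVal (k + 1) (Fml.up σ) := by
  rintro (_ | i)
  · simp [Fml.up, shiftVal, termCode]
  · have : σ i = .var (if i < k then i else i + 1) := termCode_injective (h i)
    simp only [Fml.up, this, Term.relabel, termCode, shiftVal]
    split_ifs <;> simp <;> omega

theorem describes_shift_zero :
    Describes (L := L) shiftVal 0 fun i => Term.var (i + 1) := by
  intro i
  simp [shiftVal, termCode]

theorem shiftGraph_fml_iff {c d : ℕ} : ShiftGraph L (true, 0, c, d) ↔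
    ∃ φ : Fml L, φ.code = c ∧ (φ.rename Nat.succ).code = d := by
  constructor
  · intro h
    obtain ⟨φ, hφ, h⟩ := SubstGraph.sound (fun p p' (hp : p + 1 = p') σ hσ => hp ▸ describes_shift_up p σ hσ) h
    exact ⟨φ, hφ, h _ describes_shift_zero⟩
  · rintro ⟨φ, rfl, rfl⟩
    exact SubstGraph.fml (fun p σ hσ => ⟨p + 1, rfl, describes_shift_up p σ hσ⟩)
      describes_shift_zero φ

theorem shiftGraph_term_iff {c d : ℕ} : ShiftGraph L (false, 0, c, d) ↔
    ∃ t : L.Term ℕ, termCode t = c ∧ termCode (t.relabel Nat.succ) = d := by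
  simp only [relabel_eq_subst]
  constructor
  · intro h
    obtain ⟨φ, hφ, h⟩ := SubstGraph.sound (fun p p' (hp : p + 1 = p') σ hσ => hp ▸ describes_shift_up p σ hσ) h
    exact ⟨φ, hφ, h _ describes_shift_zero⟩
  · rintro ⟨t, rfl, rfl⟩
    exact SubstGraph.term _ _ describes_shift_zero t

theorem describes_inst_up {p p' : ℕ × ℕ} (hp : InstLift L (p, p')) (σ : ℕ → L.Term ℕ)
    (h : Describes instVal p σ) : Describes instVal p' (Fml.up σ) := by
  obtain ⟨k, c⟩ := p
  obtain ⟨k', c'⟩ := p'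
  obtain ⟨rfl : k + 1 = k', hc⟩ := hp
  obtain ⟨t, rfl : termCode t = c, rfl : _ = c'⟩ := shiftGraph_term_iff.1 hc
  rintro (_ | i)
  · simp [Fml.up, instVal, termCode]
  · have hi := h i
    simp only [instVal] at hi ⊢
    simp only [Fml.up]
    split_ifs at hi with h₁ h₂
    · rw [termCode_injective hi, if_pos (by omega)]
    · have : σ i = .var i := termCode_injective hi
      rw [this, if_neg (by omega), if_pos (by omega)]
      rfl
    · have : σ i = .var (i - 1) := termCode_injective hi
      rw [this, if_neg (by omega), if_neg (by omega), Term.relabel, termCode]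
      congr 1
      simp only [Nat.succ_eq_add_one]
      omega

theorem describes_inst_zero (t : L.Term ℕ) : Describes (L := L) instVal (0, termCode t)
    fun i => Nat.casesOn i t Term.var := by
  rintro (_ | i) <;> simp [instVal, termCode]

/-- The second conjunct says that `e` is the number of a term. Without it the parameter `(0, e)`
might describe no substitution, and soundness would be vacuous. -/
theorem instGraph_iff {e c d : ℕ} : InstGraph L (true, (0, e), c, d) ∧
    (∃ e', ShiftGraph L (false, 0, e, e')) ↔
    ∃ (φ : Fml L) (t : L.Term ℕ), φ.code = c ∧ termCode t = e ∧ (φ.inst t).code = d := by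
  constructor
  · rintro ⟨h, _, he⟩
    obtain ⟨t, rfl, -⟩ := shiftGraph_term_iff.1 he
    obtain ⟨φ, hφ, h⟩ := SubstGraph.sound (fun p p' hp σ hσ => describes_inst_up hp σ hσ) h
    exact ⟨φ, t, hφ, rfl, h _ (describes_inst_zero t)⟩
  · rintro ⟨φ, t, rfl, rfl, rfl⟩
    refine ⟨SubstGraph.fml (fun p σ hσ => ?_) (describes_inst_zero t) φ, _,
      shiftGraph_term_iff.2 ⟨t, rfl, rfl⟩⟩
    -- Since `p` describes σ, the term with number `p.2` is `σ p.1`.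
    have hp : InstLift L (p, (p.1 + 1, termCode ((σ p.1).relabel Nat.succ))) :=
      ⟨rfl, shiftGraph_term_iff.2 ⟨σ p.1, by simp [hσ p.1, instVal], rfl⟩⟩
    exact ⟨_, hp, describes_inst_up hp σ hσ⟩

end Substitution

/-! ### Recursive enumerability of the syntactic notions -/

section Recursive

variable {L : FirstOrder.Language.{u, v}} [Encodable (Σ k, L.Functions k)]
  [Encodable (Σ k, L.Relations k)]

/-- The numbers of formulas are the domain of the shift graph, so no separate definition of
well-formedness on numbers is needed. -/
theorem rePred_isFmlCode (hL : RecursivelyNumbered L) :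
    REPred fun c : ℕ => ∃ φ : Fml L, φ.code = c :=
  (REPred.exists_snd (p := fun x : ℕ × ℕ => ShiftGraph L (true, 0, x.1, x.2))
    ((ShiftGraph.rePred hL).comp (by fun_prop))).of_eq fun c => by simp [shiftGraph_fml_iff]

theorem rePred_isTermCode (hL : RecursivelyNumbered L) :
    REPred fun c : ℕ => ∃ t : L.Term ℕ, termCode t = c :=
  (REPred.exists_snd (p := fun x : ℕ × ℕ => ShiftGraph L (false, 0, x.1, x.2))
    ((ShiftGraph.rePred hL).comp (by fun_prop))).of_eq fun c => by simp [shiftGraph_term_iff]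

theorem rePred_shift (hL : RecursivelyNumbered L) :
    REPred fun x : ℕ × ℕ => ∃ φ : Fml L, φ.code = x.1 ∧ (φ.rename Nat.succ).code = x.2 :=
  ((ShiftGraph.rePred hL).comp (f := fun x : ℕ × ℕ => (true, 0, x.1, x.2))
    (by fun_prop)).of_eq fun _ => shiftGraph_fml_iff

theorem rePred_inst (hL : RecursivelyNumbered L) :
    REPred fun x : ℕ × ℕ × ℕ => ∃ (φ : Fml L) (t : L.Term ℕ), φ.code = x.1 ∧ termCode t = x.2.1 ∧
      (φ.inst t).code = x.2.2 := by
  refine REPred.of_eq (.and ((InstGraph.rePred hL).comp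
    (f := fun x : ℕ × ℕ × ℕ => (true, (0, x.2.1), x.1, x.2.2)) (by fun_prop))
    (REPred.exists_snd (p := fun y : (ℕ × ℕ × ℕ) × ℕ => ShiftGraph L (false, 0, y.1.2.1, y.2))
    ((ShiftGraph.rePred hL).comp (by fun_prop)))) fun x => instGraph_iff

end Recursive

end Rosser

namespace Rosser

open FirstOrder.Language (Term)

/-! ### The Hilbert calculus on Gödel numbers -/

section Provability

variable {L : FirstOrder.Language.{u, v}} [Encodable (Σ k, L.Functions k)]
  [Encodable (Σ k, L.Relations k)]

/-- The code of an implication. -/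
abbrev impCode (a b : ℕ) : ℕ := Nat.pair 3 (Nat.pair a b)

/-- The code of a negation. -/
abbrev negCode (a : ℕ) : ℕ := impCode a (Nat.pair 0 0)

/-- The code of a universally quantified formula. -/
abbrev allCode (a : ℕ) : ℕ := Nat.pair 4 a

/-- The code of an equation. -/
abbrev equalCode (a b : ℕ) : ℕ := Nat.pair 1 (Nat.pair a b)

variable (L) in
def IsFmlCode (c : ℕ) : Prop := ∃ φ : Fml L, φ.code = c

variable (L) in
def IsTermCode (c : ℕ) : Prop := ∃ t : L.Term ℕ, termCode t = c

variable (L) in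
def IsShiftCode (x : ℕ × ℕ) : Prop := ∃ φ : Fml L, φ.code = x.1 ∧ (φ.rename Nat.succ).code = x.2

variable (L) in
def IsInstCode (x : ℕ × ℕ × ℕ) : Prop :=
  ∃ (φ : Fml L) (t : L.Term ℕ), φ.code = x.1 ∧ termCode t = x.2.1 ∧ (φ.inst t).code = x.2.2

/-- The rules of the Hilbert calculus on Gödel numbers. -/
def ProofRule (T : Set (Fml L)) (x : List ℕ × ℕ) : Prop :=
  (∃ w : ℕ, (∃ φ ∈ T, φ.code = w) ∧ ([], w) = x) ∨
  (∃ w : ℕ × ℕ, (IsFmlCode L w.1 ∧ IsFmlCode L w.2) ∧ ([], impCode w.1 (impCode w.2 w.1)) = x) ∨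
  (∃ w : ℕ × ℕ × ℕ, (IsFmlCode L w.1 ∧ IsFmlCode L w.2.1 ∧ IsFmlCode L w.2.2) ∧
    ([], impCode (impCode w.1 (impCode w.2.1 w.2.2))
      (impCode (impCode w.1 w.2.1) (impCode w.1 w.2.2))) = x) ∨
  (∃ w : ℕ, IsFmlCode L w ∧ ([], impCode (negCode (negCode w)) w) = x) ∨
  (∃ w : ℕ × ℕ × ℕ, IsInstCode L w ∧ ([], impCode (allCode w.1) w.2.2) = x) ∨
  (∃ w : ℕ × ℕ, (IsFmlCode L w.1 ∧ IsFmlCode L w.2) ∧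
    ([], impCode (allCode (impCode w.1 w.2)) (impCode (allCode w.1) (allCode w.2))) = x) ∨
  (∃ w : ℕ × ℕ, IsShiftCode L w ∧ ([], impCode w.1 (allCode w.2)) = x) ∨
  (∃ w : ℕ, IsTermCode L w ∧ ([], equalCode w w) = x) ∨
  (∃ w : ℕ × (ℕ × ℕ) × ℕ × ℕ, (IsInstCode L (w.1, w.2.1) ∧ IsInstCode L (w.1, w.2.2)) ∧
    ([], impCode (equalCode w.2.1.1 w.2.2.1) (impCode w.2.1.2 w.2.2.2)) = x) ∨
  (∃ w : ℕ × ℕ, ([impCode w.1 w.2, w.1], w.2) = x) ∨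
  (∃ w : ℕ, ([w], allCode w) = x)

theorem rePred_proofRule (hL : RecursivelyNumbered L) {T : Set (Fml L)} (hT : IsRETheory T) :
    REPred (ProofRule T) := by
  have hF : REPred (IsFmlCode L) := rePred_isFmlCode hL
  have hI : REPred (IsInstCode L) := rePred_inst hL
  have hS : REPred (IsShiftCode L) := rePred_shift hL
  have hM : REPred (IsTermCode L) := rePred_isTermCode hL
  refine .or (.image hT.re ?_) <| .or (.image (.and (hF.comp ?_) (hF.comp ?_)) ?_) <|
    .or (.image (.and (hF.comp ?_) (.and (hF.comp ?_) (hF.comp ?_))) ?_) <|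
    .or (.image hF ?_) <| .or (.image hI ?_) <|
    .or (.image (.and (hF.comp ?_) (hF.comp ?_)) ?_) <| .or (.image hS ?_) <|
    .or (.image hM ?_) <| .or (.image (.and (hI.comp ?_) (hI.comp ?_)) ?_) <|
    .or (.range ?_) (.range ?_) <;>
  exact Primrec.to_comp (by fun_prop)

/-- The rules imitate the calculus one by one. Injectivity of the numbering identifies the formulas
behind equal numbers, in modus ponens and in the two instances of the equality axiom. -/
theorem generated_proofRule_iff {T : Set (Fml L)} {c : ℕ} :
    Generated (ProofRule T) c ↔ ∃ φ : Fml L, φ.code = c ∧ Provable T φ := by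
  constructor
  · intro h
    induction h with
    | @intro l c h _ ih =>
      rcases h with ⟨w, ⟨φ, hφ, rfl⟩, h⟩ | ⟨⟨_, _⟩, ⟨⟨φ, rfl⟩, ⟨ψ, rfl⟩⟩, h⟩ |
        ⟨⟨_, _, _⟩, ⟨⟨φ, rfl⟩, ⟨ψ, rfl⟩, ⟨χ, rfl⟩⟩, h⟩ | ⟨_, ⟨φ, rfl⟩, h⟩ |
        ⟨⟨_, _, _⟩, ⟨φ, t, rfl, rfl, rfl⟩, h⟩ | ⟨⟨_, _⟩, ⟨⟨φ, rfl⟩, ⟨ψ, rfl⟩⟩, h⟩ |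
        ⟨⟨_, _⟩, ⟨φ, rfl, rfl⟩, h⟩ | ⟨_, ⟨t, rfl⟩, h⟩ |
        ⟨⟨_, ⟨_, _⟩, _, _⟩, ⟨⟨φ, s, rfl, rfl, rfl⟩, ⟨ψ, t, h₁, rfl, rfl⟩⟩, h⟩ | ⟨⟨a, b⟩, h⟩ | ⟨a, h⟩ <;>
        cases h
      · exact ⟨φ, rfl, .ax hφ⟩
      · exact ⟨_, rfl, .imp_k φ ψ⟩
      · exact ⟨_, rfl, .imp_s φ ψ χ⟩
      · exact ⟨_, rfl, .dne φ⟩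
      · exact ⟨_, rfl, .all_inst φ t⟩
      · exact ⟨_, rfl, .all_imp φ ψ⟩
      · exact ⟨_, rfl, .all_vac φ⟩
      · exact ⟨_, rfl, .eq_refl t⟩
      · cases code_injective h₁
        exact ⟨_, rfl, .eq_subst φ s t⟩
      · obtain ⟨χ, h₁, hχ⟩ := ih (impCode a b) (by simp)
        obtain ⟨φ, rfl, hφ⟩ := ih a (by simp)
        cases χ with
        | imp φ' ψ =>
          simp only [Fml.code, Nat.pair_eq_pair, true_and] at h₁
          cases code_injective h₁.1
          exact ⟨ψ, h₁.2, hχ.mp hφ⟩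
        | _ => simp [Fml.code] at h₁
      · obtain ⟨φ, rfl, hφ⟩ := ih a (by simp)
        exact ⟨φ.all, rfl, hφ.gen⟩
  · rintro ⟨φ, rfl, h⟩
    induction h with
    | @ax φ h => exact .intro (l := []) (.inl ⟨_, ⟨φ, h, rfl⟩, rfl⟩) (by simp)
    | imp_k φ ψ =>
      exact .intro (l := []) (.inr (.inl ⟨(φ.code, ψ.code), ⟨⟨φ, rfl⟩, ⟨ψ, rfl⟩⟩, rfl⟩)) (by simp)
    | imp_s φ ψ χ =>
      exact .intro (l := []) (.inr (.inr (.inl ⟨(φ.code, ψ.code, χ.code),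
        ⟨⟨φ, rfl⟩, ⟨ψ, rfl⟩, ⟨χ, rfl⟩⟩, rfl⟩))) (by simp)
    | dne φ => exact .intro (l := []) (.inr (.inr (.inr (.inl ⟨_, ⟨φ, rfl⟩, rfl⟩)))) (by simp)
    | all_inst φ t =>
      exact .intro (l := []) (.inr (.inr (.inr (.inr (.inl ⟨(φ.code, termCode t, (φ.inst t).code),
        ⟨φ, t, rfl, rfl, rfl⟩, rfl⟩))))) (by simp)
    | all_imp φ ψ =>
      exact .intro (l := []) (.inr (.inr (.inr (.inr (.inr (.inl ⟨(φ.code, ψ.code),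
        ⟨⟨φ, rfl⟩, ⟨ψ, rfl⟩⟩, rfl⟩)))))) (by simp)
    | all_vac φ =>
      exact .intro (l := []) (.inr (.inr (.inr (.inr (.inr (.inr (.inl
        ⟨(φ.code, (φ.rename Nat.succ).code), ⟨φ, rfl, rfl⟩, rfl⟩))))))) (by simp)
    | eq_refl t =>
      exact .intro (l := []) (.inr (.inr (.inr (.inr (.inr (.inr (.inr (.inl
        ⟨_, ⟨t, rfl⟩, rfl⟩)))))))) (by simp)
    | eq_subst φ s t =>
      exact .intro (l := []) (.inr (.inr (.inr (.inr (.inr (.inr (.inr (.inr (.inl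
        ⟨(φ.code, (termCode s, (φ.inst s).code), termCode t, (φ.inst t).code),
          ⟨⟨φ, s, rfl, rfl, rfl⟩, ⟨φ, t, rfl, rfl, rfl⟩⟩, rfl⟩))))))))) (by simp)
    | @mp φ ψ _ _ ih₁ ih₂ =>
      refine .intro (.inr (.inr (.inr (.inr (.inr (.inr (.inr (.inr (.inr (.inl
        ⟨(φ.code, ψ.code), rfl⟩)))))))))) ?_
      simpa using ⟨ih₁, ih₂⟩
    | @gen φ _ ih =>
      refine .intro (.inr (.inr (.inr (.inr (.inr (.inr (.inr (.inr (.inr (.inr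
        ⟨φ.code, rfl⟩)))))))))) ?_
      simpa using ih

/-- The theorems of a recursively enumerable theory form a recursively enumerable set. -/
theorem rePred_provable (hL : RecursivelyNumbered L) {T : Set (Fml L)} (hT : IsRETheory T) :
    REPred fun c : ℕ => ∃ φ : Fml L, φ.code = c ∧ Provable T φ :=
  (REPred.generated (rePred_proofRule hL hT)).of_eq fun _ => generated_proofRule_iff

/-! ### The code of the sentence `φ(a₁^I, …, aₙ^I)` -/

/-- The code of a conjunction. -/
abbrev andCode (a b : ℕ) : ℕ := negCode (impCode a (negCode b))

/-- The code of an existentially quantified formula. -/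
abbrev exCode (a : ℕ) : ℕ := negCode (allCode (negCode a))

/-- The translation enters only through the numbers of three fixed formulas, so it needs no
effectiveness assumption. -/
theorem exists_primrec_numeralFml (I : Translation numLang L) :
    ∃ g : ℕ → ℕ, Primrec g ∧ ∀ a, (I.numeralFml a).code = g a := by
  refine ⟨Nat.rec (I.func zeroSymb).code fun _ c =>
    exCode (andCode I.dom.code (andCode c (I.func succSymb).code)),
    Primrec.nat_rec₁ _ (show Primrec _ by fun_prop), fun a => ?_⟩
  induction a with
  | zero => rfl
  | succ a ih =>
    simp only [Translation.numeralFml, Fml.ex, Fml.and, Fml.neg, Fml.code, ih]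

theorem exists_primrec_apply (I : Translation numLang L) (n : ℕ) :
    ∃ g : ℕ × (Fin n → ℕ) → ℕ, Primrec g ∧
      ∀ (φ : Fml L) (a : Fin n → ℕ), (I.apply φ a).code = g (φ.code, a) := by
  obtain ⟨h, hh, hI⟩ := exists_primrec_numeralFml I
  have hlist : Primrec fun a : Fin n → ℕ => List.ofFn a :=
    (Primrec.vector_toList.comp Primrec.vector_ofFn').of_eq fun a => by simp
  refine ⟨fun x => (List.ofFn x.2).foldl
    (fun c a => exCode (andCode (andCode I.dom.code (h a)) c)) x.1,
    Primrec.list_foldl (h := fun _ y => exCode (andCode (andCode I.dom.code (h y.2)) y.1))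
      (hlist.comp Primrec.snd) Primrec.fst (show Primrec _ by fun_prop), fun φ a => ?_⟩
  change (I.applyList (List.ofFn a) φ).code = (List.ofFn a).foldl _ φ.code
  generalize List.ofFn a = l
  induction l generalizing φ with
  | nil => rfl
  | cons b l ih =>
    simp only [Translation.applyList, ih, List.foldl_cons]
    simp only [Fml.ex, Fml.and, Fml.neg, Fml.code, hI]

/-- Provability and refutability of the sentences `φ(a₁^I, …, aₙ^I)` in terms of the code
of `φ`. -/
theorem exists_rePred_apply (hL : RecursivelyNumbered L) {T : Set (Fml L)} (hT : IsRETheory T)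
    (I : Translation numLang L) (n : ℕ) :
    ∃ P Q : ℕ × (Fin n → ℕ) → Prop, REPred P ∧ REPred Q ∧ ∀ (φ : Fml L) (a : Fin n → ℕ),
      (P (φ.code, a) ↔ Provable T (I.apply φ a)) ∧
      (Q (φ.code, a) ↔ Provable T (I.apply φ a).neg) := by
  obtain ⟨g, hg, hI⟩ := exists_primrec_apply I n
  have key : ∀ ψ : Fml L, (∃ φ : Fml L, φ.code = ψ.code ∧ Provable T φ) ↔ Provable T ψ :=
    fun ψ => ⟨fun ⟨_, h, hφ⟩ => code_injective h ▸ hφ, fun h => ⟨ψ, rfl, h⟩⟩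
  refine ⟨_, _, (rePred_provable hL hT).comp hg.to_comp,
    (rePred_provable hL hT).comp (f := fun x => negCode (g x)) (by fun_prop), fun φ a => ⟨?_, ?_⟩⟩
  · rw [← hI, key]
  · rw [← hI, ← key (I.apply φ a).neg]
    rfl

end Provability

/-! ### Fixed points in an acceptable listing, and the two Rosser properties -/

section Separation

variable {n : ℕ} {R : ℕ → Set (Fin n → ℕ)}

/-- Parameters are moved to ℕ along their encoding; numbers that encode no parameter index the empty
relation. -/
theorem IsAcceptableListing.exists_index (hR : IsAcceptableListing R) {δ : Type*} [Primcodable δ]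
    {p : δ × (Fin n → ℕ) → Prop} (hp : REPred p) :
    ∃ h : δ → ℕ, Computable h ∧ ∀ d a, a ∈ R (h d) ↔ p (d, a) := by
  have hS : REPred fun x : ℕ × (Fin n → ℕ) => ∃ d : δ, Encodable.encode d = x.1 ∧ p (d, x.2) :=
    REPred.exists_snd (p := fun y : (ℕ × (Fin n → ℕ)) × δ =>
      Encodable.encode y.2 = y.1.1 ∧ p (y.2, y.1.2))
      (.and (.eq (by fun_prop) (by fun_prop)) (hp.comp (by fun_prop)))
  obtain ⟨h, hh, hRh⟩ := hR.index
    (fun i => {a | ∃ d : δ, Encodable.encode d = i ∧ p (d, a)}) hS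
  refine ⟨fun d => h (Encodable.encode d), by fun_prop, fun d a => ?_⟩
  rw [hRh]
  constructor
  · rintro ⟨d', hd, h⟩
    exact Encodable.encode_injective hd ▸ h
  · exact fun h => ⟨d, rfl, h⟩

/-- The double recursion theorem for an acceptable listing: two uniformly recursively enumerable
families may refer to their own indices. -/
theorem IsAcceptableListing.exists_fixed_point (hR : IsAcceptableListing R) {δ : Type*}
    [Primcodable δ] {p q : (δ × ℕ × ℕ) × (Fin n → ℕ) → Prop} (hp : REPred p) (hq : REPred q) :
    ∃ h k : δ → ℕ, Computable h ∧ Computable k ∧ ∀ d a,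
      (a ∈ R (h d) ↔ p ((d, h d, k d), a)) ∧ (a ∈ R (k d) ↔ q ((d, h d, k d), a)) := by
  -- The program in the first component, run on `d`, outputs the given pair of indices.
  let val : (Nat.Partrec.Code × δ) × ℕ × ℕ → Prop := fun x =>
    Encodable.encode x.2 ∈ x.1.1.eval (Encodable.encode x.1.2)
  have hval : REPred val := by
    have h := Partrec.bind (f := fun x : (Nat.Partrec.Code × δ) × ℕ × ℕ =>
      x.1.1.eval (Encodable.encode x.1.2))
      (g := fun x y => Part.assert (y = Encodable.encode x.2) fun _ => Part.some ())
      (Nat.Partrec.Code.eval_part.comp (by fun_prop) (by fun_prop))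
      (REPred.eq (α := ((Nat.Partrec.Code × δ) × ℕ × ℕ) × ℕ) (f := fun x => x.2)
        (g := fun x => Encodable.encode x.1.2) (by fun_prop) (by fun_prop))
    refine h.dom_re.of_eq fun x => ?_
    simp only [Part.dom_iff_mem, Part.mem_bind_iff, Part.mem_assert_iff, val]
    constructor
    · rintro ⟨_, c, hc, rfl, _⟩; exact hc
    · exact fun hb => ⟨(), _, hb, rfl, by simp⟩
  -- The index is computed from the program and `d` without running the program; if it does not
  -- output a pair, the relation is empty.
  have lift : ∀ {p : (δ × ℕ × ℕ) × (Fin n → ℕ) → Prop}, REPred p →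
      ∃ h : Nat.Partrec.Code × δ → ℕ, Computable h ∧
        ∀ x a, a ∈ R (h x) ↔ ∃ y, val (x, y) ∧ p ((x.2, y), a) := fun hp =>
    hR.exists_index (p := fun z => ∃ y, val (z.1, y) ∧ _) (REPred.exists_snd
      (p := fun z : ((Nat.Partrec.Code × δ) × (Fin n → ℕ)) × ℕ × ℕ =>
        val (z.1.1, z.2) ∧ _) (.and (hval.comp (by fun_prop))
        (hp.comp (f := fun z : ((Nat.Partrec.Code × δ) × (Fin n → ℕ)) × ℕ × ℕ =>
          ((z.1.1.2, z.2), z.1.2)) (by fun_prop))))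
  obtain ⟨h, hh, hp'⟩ := lift hp
  obtain ⟨k, hk, hq'⟩ := lift hq
  -- Kleene's recursion theorem gives a program `c` whose output on `d` is the pair of indices
  -- obtained from `c` and `d` themselves. One fixed point of a pair-valued map thus serves both
  -- families.
  obtain ⟨c, hc⟩ := Nat.Partrec.Code.fixed_point₂
    (f := fun c m => ((Encodable.decode (α := δ) m).map fun d =>
      Encodable.encode (h (c, d), k (c, d)) : Option ℕ))
    (Computable.ofOption (Computable.option_map (f := fun x : Nat.Partrec.Code × ℕ =>
      Encodable.decode (α := δ) x.2) (Computable.decode.comp Computable.snd)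
      (show Computable _ by fun_prop)))
  have heval : ∀ d y, val ((c, d), y) ↔ y = (h (c, d), k (c, d)) := by
    intro d y
    simp [val, hc, -Encodable.encode_prod_val]
  refine ⟨fun d => h (c, d), fun d => k (c, d), by fun_prop, by fun_prop, fun d a => ⟨?_, ?_⟩⟩
  · rw [hp']; simp [heval]
  · rw [hq']; simp [heval]

variable {L : FirstOrder.Language.{u, v}} [Encodable (Σ k, L.Functions k)]
  [Encodable (Σ k, L.Relations k)] {T : Set (Fml L)}

/-- The fixed point puts refutations on the side of `R i` and proofs on the side of `R j`. Each
failure of exactness then places the tuple in just one of the two new relations, where separation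
contradicts the failure, with the help of consistency in the converse directions. -/
theorem EffectivelyRosser.exact (hL : RecursivelyNumbered L) (hT : IsRETheory T)
    (hcons : Consistent T) (hR : IsAcceptableListing R) (h : EffectivelyRosser R T) :
    EffectivelyExactRosser R T := by
  obtain ⟨I, hI, f, hf, hfR⟩ := h
  obtain ⟨P, Q, hP, hQ, hPQ⟩ := exists_rePred_apply hL hT I n
  have hf' : Computable fun x : ℕ × ℕ => f x.1 x.2 := hf
  have hcomp : Computable fun x : ((ℕ × ℕ) × ℕ × ℕ) × (Fin n → ℕ) => (f x.1.2.1 x.1.2.2, x.2) :=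
    (hf'.comp (g := fun x : ((ℕ × ℕ) × ℕ × ℕ) × (Fin n → ℕ) => x.1.2) (by fun_prop)).pair
      Computable.snd
  have hp : REPred fun x : ((ℕ × ℕ) × ℕ × ℕ) × (Fin n → ℕ) =>
      x.2 ∈ R x.1.1.1 ∨ Q (f x.1.2.1 x.1.2.2, x.2) :=
    (hR.re.comp (f := fun x : ((ℕ × ℕ) × ℕ × ℕ) × (Fin n → ℕ) => (x.1.1.1, x.2))
      (by fun_prop)).or (hQ.comp hcomp)
  have hq : REPred fun x : ((ℕ × ℕ) × ℕ × ℕ) × (Fin n → ℕ) =>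
      x.2 ∈ R x.1.1.2 ∨ P (f x.1.2.1 x.1.2.2, x.2) :=
    (hR.re.comp (f := fun x : ((ℕ × ℕ) × ℕ × ℕ) × (Fin n → ℕ) => (x.1.1.2, x.2))
      (by fun_prop)).or (hP.comp hcomp)
  obtain ⟨h, k, hh, hk, hhk⟩ := hR.exists_fixed_point hp hq
  refine ⟨I, hI, fun i j => f (h (i, j)) (k (i, j)),
    (hf.comp hh hk).to₂, fun i j hij => ?_⟩
  obtain ⟨φ, hφ, hcode, hsep⟩ := hfR (h (i, j)) (k (i, j))
  refine ⟨φ, hφ, hcode, fun a => ?_⟩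
  have h₁ := (hhk (i, j) a).1
  have h₂ := (hhk (i, j) a).2
  simp only [← hcode, (hPQ φ a).1, (hPQ φ a).2] at h₁ h₂
  have hnot : Provable T (I.apply φ a) → ¬ Provable T (I.apply φ a).neg :=
    fun hp hn => hcons (hn.mp hp)
  have hpos : a ∈ R i → Provable T (I.apply φ a) := fun hi => by
    by_contra hp
    exact hp ((hsep a).1 ⟨h₁.2 (.inl hi),
      fun hk => (h₂.1 hk).elim (Set.disjoint_left.1 hij hi) hp⟩)
  have hneg : a ∈ R j → Provable T (I.apply φ a).neg := fun hj => by
    by_contra hn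
    exact hn ((hsep a).2 ⟨h₂.2 (.inl hj),
      fun hk => (h₁.1 hk).elim (fun hi => Set.disjoint_left.1 hij hi hj) hn⟩)
  refine ⟨⟨hpos, fun hp => ?_⟩, ⟨hneg, fun hn => ?_⟩⟩
  · by_contra hi
    exact hnot hp ((hsep a).2 ⟨h₂.2 (.inr hp), fun hk => (h₁.1 hk).elim hi (hnot hp)⟩)
  · by_contra hj
    have hp : ¬ Provable T (I.apply φ a) := fun hp => hnot hp hn
    exact hp ((hsep a).1 ⟨h₁.2 (.inr hn), fun hk => (h₂.1 hk).elim hj hp⟩)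

/-- Reduction makes the pair disjoint while keeping each difference on its own side, with new
indices computable from `(i, j)`. -/
theorem EffectivelyExactRosser.effectivelyRosser (hR : IsAcceptableListing R)
    (h : EffectivelyExactRosser R T) : EffectivelyRosser R T := by
  obtain ⟨I, hI, f, hf, hfR⟩ := h
  obtain ⟨p, q, hp, hq, hdisj, hpR, hqR⟩ := REPred.reduction
    (hR.re.comp (f := fun x : (ℕ × ℕ) × (Fin n → ℕ) => (x.1.1, x.2)) (by fun_prop))
    (hR.re.comp (f := fun x : (ℕ × ℕ) × (Fin n → ℕ) => (x.1.2, x.2)) (by fun_prop))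
  obtain ⟨h, hh, hp⟩ := hR.exists_index hp
  obtain ⟨k, hk, hq⟩ := hR.exists_index hq
  have hf' : Computable fun x : ℕ × ℕ => f x.1 x.2 := hf
  refine ⟨I, hI, fun i j => f (h (i, j)) (k (i, j)),
    (hf.comp hh hk).to₂, fun i j => ?_⟩
  obtain ⟨φ, hφ, hcode, hsep⟩ := hfR (h (i, j)) (k (i, j)) <|
    Set.disjoint_left.2 fun a ha hb => hdisj _ ⟨(hp _ _).1 ha, (hq _ _).1 hb⟩
  exact ⟨φ, hφ, hcode, fun a => ⟨fun ha => (hsep a).1.1 ((hp _ _).2 (hpR _ ha.1 ha.2)),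
    fun ha => (hsep a).2.1 ((hq _ _).2 (hqR _ ha.1 ha.2))⟩⟩

end Separation

end Rosser

theorem mainTheorem2 {L : FirstOrder.Language.{u, v}}
    [Encodable (Σ k, L.Functions k)] [Encodable (Σ k, L.Relations k)]
    (hL : Rosser.RecursivelyNumbered L)
    (T : Set (Rosser.Fml L)) (hT : Rosser.IsRETheory T) (hcons : Rosser.Consistent T)
    (n : ℕ) (hn : 1 ≤ n) (R : ℕ → Set (Fin n → ℕ)) (hR : Rosser.IsAcceptableListing R) :
    Rosser.EffectivelyRosser R T ↔ Rosser.EffectivelyExactRosser R T :=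
  ⟨fun h => h.exact hL hT hcons hR, fun h => h.effectivelyRosser hR⟩
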